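/- For $F:I^2\to I$, where $I\subseteq\mathbb R$ is a proper interval (an interval with nonempty interior), call $F$ \emph{partially strictly increasing} if $x\mapsto F(x,y_0)$ and $y\mapsto F(x_0,y)$ are strictly increasing on $I$ for all $x_0,y_0\in I$; \emph{associative} if $F(F(x,y),z)=F(x,F(y,z))$; \emph{symmetric} if $F(x,y)=F(y,x)$; and \emph{bisymmetric} if $F(F(x,y),F(u,v))=F(F(x,u),F(y,v))$, for all arguments in $I$. For $H_0\subseteq\mathbb R$ put $H_{i+1}=H_i\cup(H_i+H_i)$ for $i\ge 0$ and $H=\bigcup_{i\ge0}H_i$, and let $H'$ be the set $H$ with all those points $b\in H$ removed for which there is $a<b$ with $(a,b)\cap H=\emptyset$ (the right endpoints of the gaps of $H$, including the minimum of $H$ if it exists). \textbf{Theorem.} There exist a proper interval $I\subseteq\mathbb R$ and a function $F:I^2\to I$ that is associative, partially strictly increasing and not continuous; indeed, for all $x_0,y_0\in I$ the sections $F(x_0,\cdot)$ and $F(\cdot,y_0)$ are not continuous on $I$. Moreover, $F$ can be chosen to be also symmetric and bisymmetric, and of the form $$F(x,y)=f^{-1}\bigl(f(x)+f(y)\bigr)\qquad(x,y\in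 I),$$ where $f:I\to H'$ is a strictly increasing bijection, $f(x)+f(y)\in H'$ for all $x,y\in I$, and $H'$ is obtained as above from a nonempty perfect set $H_0\subseteq[1,2]$ that is linearly independent over $\mathbb Q$ and contains no nondegenerate interval. Such an $F$ is not a continuous quasi-sum: there are no proper interval $J\subseteq\mathbb R$ with $J+J\subseteq J$ and continuous strictly increasing bijection $g:J\to I$ such that $F(x,y)=g\bigl(g^{-1}(x)+g^{-1}(y)\bigr)$ for all $x,y\in I$. Hence continuity cannot be dropped from Aczél's characterization of associative quasi-sums. -/

import Mathlib

namespace IntervalOp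

/-- A proper interval of the real line: order convex, with nonempty interior. -/
def IsProperInterval (I : Set ℝ) : Prop :=
  I.OrdConnected ∧ (interior I).Nonempty

section Operations

variable {I : Set ℝ}

/-- Both one-variable sections are strictly increasing. -/
def IsPartiallyStrictlyIncreasing (F : I × I → I) : Prop :=
  (∀ y₀ : I, StrictMono fun x : I => F (x, y₀)) ∧
    (∀ x₀ : I, StrictMono fun y : I => F (x₀, y))

def IsSymmetric (F : I × I → I) : Prop :=
  ∀ x y : I, F (x, y) = F (y, x)

def IsBisymmetric (F : I × I → I) : Prop :=
  ∀ x y u v : I, F (F (x, y), F (u, v)) = F (F (x, u), F (y, v))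

def IsAssociative (F : I × I → I) : Prop :=
  ∀ x y z : I, F (F (x, y), z) = F (x, F (y, z))

/-- The operation has the form `F (x, y) = f (f⁻¹ x + f⁻¹ y)` for a continuous strictly increasing
bijection `f` from a proper interval `J` onto `I`; it is understood that `J` is closed under
addition, so that the right-hand side makes sense for all `x, y`. -/
def IsContinuousQuasiSum (F : I × I → I) : Prop :=
  ∃ (J : Set ℝ) (f : J → I), IsProperInterval J ∧ Continuous f ∧ StrictMono f ∧
    Function.Surjective f ∧
    ∀ s t : J, ∃ h : (s : ℝ) + t ∈ J, F (f s, f t) = f ⟨(s : ℝ) + t, h⟩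

end Operations

/-- The operation `(x, y) ↦ f⁻¹ (α f(x) + β f(y))` on `X`, where `f : X → Y` is a strictly
increasing bijection between sets of reals and `α f(x) + β f(y)` always lies in `Y`. -/
noncomputable def weightedQuasiSum {X Y : Set ℝ} (α β : ℝ) (f : X ≃o Y)
    (h : ∀ x y : X, α * (f x : ℝ) + β * (f y : ℝ) ∈ Y) : X × X → X :=
  fun p => f.symm ⟨α * (f p.1 : ℝ) + β * (f p.2 : ℝ), h p.1 p.2⟩

/-- The layers `H₀`, `Hᵢ₊₁ = Hᵢ ∪ (α Hᵢ + β Hᵢ)`. -/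
def layer (α β : ℝ) (H₀ : Set ℝ) : ℕ → Set ℝ
  | 0 => H₀
  | i + 1 => layer α β H₀ i ∪
      {z | ∃ x ∈ layer α β H₀ i, ∃ y ∈ layer α β H₀ i, z = α * x + β * y}

/-- `H = ⋃ᵢ Hᵢ`. -/
def generatedSet (α β : ℝ) (H₀ : Set ℝ) : Set ℝ :=
  ⋃ i : ℕ, layer α β H₀ i

/-- The points of `H` that are right endpoints of an interval disjoint from `H`. If `H` has
a minimum, the minimum is one of them. -/
def rightEndpoints (H : Set ℝ) : Set ℝ :=
  {b | b ∈ H ∧ ∃ a : ℝ, a < b ∧ Set.Ioo a b ∩ H = ∅}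

/-- `H' = H \ R`. -/
def trimmedSet (α β : ℝ) (H₀ : Set ℝ) : Set ℝ :=
  generatedSet α β H₀ \ rightEndpoints (generatedSet α β H₀)

/-- A nonempty perfect subset of `[1, 2]` that is linearly independent over `ℚ` and contains no
nondegenerate interval. -/
def IsBaseSet (H₀ : Set ℝ) : Prop :=
  H₀ ⊆ Set.Icc 1 2 ∧ H₀.Nonempty ∧ Perfect H₀ ∧ LinearIndepOn ℚ (id : ℝ → ℝ) H₀ ∧
    interior H₀ = ∅

end IntervalOp

namespace IntervalOp

open Filter Topology Set

/-! ### A perfect set of reals that is linearly independent over `ℚ` -/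

/-! The set `H` is closed, perfect and stable under addition. Its points that are limits of `H` from
the left form `H'`. Passing to `H'` collapses every gap to its left endpoint, so `H'` is order
isomorphic to `ℝ`, and `H + H' ⊆ H'`. Addition on `H'`, transported along an isomorphism `f` from
the line, inherits associativity, symmetry, bisymmetry and strict monotonicity.

Continuity fails because `H` has a gap `(a, b)` with `a ∈ H'`. Just to the right of `f⁻¹ a`, the
values of `f` are at least `b`, so those of `f x₀ + f y` are at least `f x₀ + b`. This point lies in
`H'`, hence is a limit of `H'` from the left, so `H'` has points between `f x₀ + a` and `f x₀ + b`,
which the section jumps over. A continuous quasi-sum has continuous sections.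

The base set consists of sums of `2 ^ (-m²)` over the codes `m` of the initial segments of a binary
sequence. Different sequences share only finitely many codes, and the sparsity of the squares
excludes carries; this gives independence over `ℚ`. -/

lemma two_pow_mul_sparse_sum_eq_intCast (e : ℕ → ℤ) (m : ℕ) :
    ∃ z : ℤ, (2 : ℝ) ^ (m ^ 2) * ∑ j ∈ Finset.range (m + 1), (e j : ℝ) * (1 / 2) ^ (j ^ 2) = z := by
  refine ⟨∑ j ∈ Finset.range (m + 1), e j * 2 ^ (m ^ 2 - j ^ 2), ?_⟩
  push_cast
  rw [Finset.mul_sum]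
  refine Finset.sum_congr rfl fun j hj => ?_
  have hjm : j ^ 2 ≤ m ^ 2 := Nat.pow_le_pow_left (by simpa [Nat.lt_succ_iff] using hj) 2
  rw [pow_sub₀ _ two_ne_zero hjm, one_div, inv_pow]
  ring

lemma sparse_term_le (m k : ℕ) :
    ((1 : ℝ) / 2) ^ ((k + m) ^ 2) ≤ (1 / 2) ^ (m ^ 2) * (1 / 2) ^ k := by
  rw [← pow_add]
  refine pow_le_pow_of_le_one (by norm_num) (by norm_num) ?_
  nlinarith [Nat.zero_le (k * m), Nat.le_self_pow two_ne_zero k]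

lemma summable_sparse {e : ℕ → ℝ} {C : ℝ} (hC : ∀ m, |e m| ≤ C) :
    Summable fun m => e m * (1 / 2) ^ (m ^ 2) := by
  refine Summable.of_norm_bounded (g := fun m : ℕ => C * (1 / 2) ^ m)
    (summable_geometric_two.mul_left C) fun m => ?_
  have h := sparse_term_le 0 m
  simp only [add_zero, ne_eq, OfNat.ofNat_ne_zero, not_false_eq_true, zero_pow, pow_zero,
    one_mul] at h
  rw [norm_mul, Real.norm_eq_abs, Real.norm_of_nonneg (by positivity)]
  exact mul_le_mul (hC m) h (by positivity) ((abs_nonneg _).trans (hC m))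

lemma abs_sparse_tail_le {e : ℕ → ℝ} {C : ℝ} (hC : ∀ m, |e m| ≤ C) (m : ℕ) :
    |∑' k, e (k + m) * (1 / 2) ^ ((k + m) ^ 2)| ≤ C * (1 / 2) ^ (m ^ 2) * 2 := by
  rw [← Real.norm_eq_abs]
  refine tsum_of_norm_bounded (f := fun k => e (k + m) * (1 / 2) ^ ((k + m) ^ 2))
    (g := fun k : ℕ => C * (1 / 2) ^ (m ^ 2) * (1 / 2) ^ k)
    (hasSum_geometric_two.mul_left _) fun k => ?_
  rw [norm_mul, Real.norm_eq_abs, Real.norm_of_nonneg (by positivity), mul_assoc]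
  exact mul_le_mul (hC _) (sparse_term_le m k) (by positivity) ((abs_nonneg _).trans (hC 0))

/-- Sparse binary expansions with bounded integer digits are unique up to finitely many digits. -/
lemma eventually_eq_zero_of_sparse_tsum_eq_zero {e : ℕ → ℤ} {C : ℝ} (hC : ∀ m, |(e m : ℝ)| ≤ C)
    (h0 : ∑' m, (e m : ℝ) * (1 / 2) ^ (m ^ 2) = 0) : ∀ᶠ m in atTop, e m = 0 := by
  have hC0 : 0 ≤ C := (abs_nonneg _).trans (hC 0)
  -- Scaled by `2 ^ (m²)`, the partial sum is an integer and equals minus the scaled tail. Since `(m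
  -- + 1)² - m² = 2m + 1`, the tail is at most `2C / 2 ^ m`, which is eventually less than 1.
  have hS : ∀ᶠ m in atTop, ∑ j ∈ Finset.range (m + 1), (e j : ℝ) * (1 / 2) ^ (j ^ 2) = 0 := by
    have hlim : Tendsto (fun m : ℕ => C * 2 * (1 / 2 : ℝ) ^ m) atTop (𝓝 (C * 2 * 0)) :=
      (tendsto_pow_atTop_nhds_zero_of_lt_one (by norm_num) (by norm_num)).const_mul _
    rw [mul_zero] at hlim
    filter_upwards [hlim.eventually_lt_const one_pos] with m hm
    obtain ⟨z, hz⟩ := two_pow_mul_sparse_sum_eq_intCast e m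
    have hsplit := (summable_sparse hC).sum_add_tsum_nat_add (m + 1)
    rw [h0] at hsplit
    have htail := abs_sparse_tail_le hC (m + 1)
    rw [← neg_eq_of_add_eq_zero_right hsplit, abs_neg] at htail
    have hpow : (2 : ℝ) ^ (m ^ 2) * (1 / 2) ^ ((m + 1) ^ 2) ≤ (1 / 2) ^ m := by
      have : (m + 1) ^ 2 = m ^ 2 + (m + (m + 1)) := by ring
      rw [this, pow_add, ← mul_assoc, ← mul_pow, pow_add]
      rw [mul_one_div_cancel two_ne_zero, one_pow, one_mul]
      exact mul_le_of_le_one_right (by positivity) (pow_le_one₀ (by norm_num) (by norm_num))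
    have hzlt : |(z : ℝ)| < 1 := by
      rw [← hz, abs_mul, abs_of_pos (by positivity)]
      calc _ ≤ (2 : ℝ) ^ (m ^ 2) * (C * (1 / 2) ^ ((m + 1) ^ 2) * 2) := by gcongr
        _ = C * 2 * ((2 : ℝ) ^ (m ^ 2) * (1 / 2) ^ ((m + 1) ^ 2)) := by ring
        _ ≤ C * 2 * (1 / 2) ^ m := by gcongr
        _ < 1 := hm
    have hz0 : z = 0 := Int.abs_lt_one_iff.1 (by exact_mod_cast hzlt)
    rw [hz0, Int.cast_zero] at hz
    exact (mul_eq_zero.1 hz).resolve_left (by positivity)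
  filter_upwards [hS, (tendsto_sub_atTop_nat 1).eventually hS, eventually_ge_atTop 1] with m h1 h2 h3
  rw [Finset.sum_range_succ] at h1
  rw [Nat.sub_add_cancel h3] at h2
  rw [h2, zero_add] at h1
  exact_mod_cast (mul_eq_zero.1 h1).resolve_right (by positivity)

/-- The binary digits of `m` below the leading one form an initial segment of `a`. -/
def IsBranchCode (a : ℕ → Bool) (m : ℕ) : Prop :=
  ∀ k < Nat.log 2 m, m.testBit k = a k

/-- Put a leading one in front of the first `n` bits of `a`. -/
lemma exists_isBranchCode_ge (a : ℕ → Bool) (n : ℕ) : ∃ m, 2 ^ n ≤ m ∧ IsBranchCode a m := by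
  let b : Fin (n + 1) → Bool := fun i => if (i : ℕ) = n then true else a i
  have hbit : ∀ k (hk : k < n + 1), (Nat.ofBits b).testBit k = b ⟨k, hk⟩ := fun k hk =>
    Nat.testBit_ofBits_lt b k hk
  have hge : 2 ^ n ≤ Nat.ofBits b := Nat.ge_two_pow_of_testBit (by rw [hbit n (by omega)]; simp [b])
  have hlt : Nat.ofBits b < 2 ^ (n + 1) := Nat.ofBits_lt_two_pow b
  refine ⟨Nat.ofBits b, hge, fun k hk => ?_⟩
  have hlog : Nat.log 2 (Nat.ofBits b) < n + 1 :=
    Nat.log_lt_of_lt_pow (Nat.two_pow_pos n |>.trans_le hge).ne' hlt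
  rw [hbit k (by omega)]
  simp [b, show k ≠ n by omega]

lemma not_isBranchCode_of_ne {a b : ℕ → Bool} {k m : ℕ} (h : a k ≠ b k) (hm : 2 ^ (k + 1) ≤ m)
    (ha : IsBranchCode a m) : ¬ IsBranchCode b m := fun hb => by
  have : k < Nat.log 2 m := Nat.le_log_of_pow_le one_lt_two hm
  exact h ((ha k this).symm.trans (hb k this))

open Classical in
/-- The real number whose sparse binary expansion has a one at each code of an initial segment
of `a`. -/
noncomputable def branchReal (a : ℕ → Bool) : ℝ :=
  ∑' m, (if IsBranchCode a m then (1 : ℝ) else 0) * (1 / 2) ^ (m ^ 2)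

open Classical in
lemma abs_ite_one_zero_le (p : Prop) : |if p then (1 : ℝ) else 0| ≤ 1 := by
  split_ifs <;> simp

lemma one_le_branchReal (a : ℕ → Bool) : 1 ≤ branchReal a := by
  classical
  have h := (summable_sparse fun m => abs_ite_one_zero_le (IsBranchCode a m)).le_tsum 0
    fun m _ => by positivity
  have h0 : IsBranchCode a 0 := fun k hk => by simp at hk
  simpa [h0, branchReal] using h

lemma branchReal_le_two (a : ℕ → Bool) : branchReal a ≤ 2 := by
  classical
  have h := abs_sparse_tail_le (fun m => abs_ite_one_zero_le (IsBranchCode a m)) 0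
  simpa [branchReal] using (le_abs_self _).trans h

/-- Each digit depends on finitely many coordinates, and the series converges uniformly. -/
lemma continuous_branchReal : Continuous branchReal := by
  classical
  refine continuous_tsum (u := fun m : ℕ => ((1 : ℝ) / 2) ^ m) (fun m => ?_) summable_geometric_two
    fun m a => ?_
  · refine Continuous.mul (continuous_iff_continuousAt.2 fun a => ?_) continuous_const
    have hev : ∀ᶠ b in 𝓝 a, ∀ k ∈ Finset.range (Nat.log 2 m), b k = a k :=
      (Finset.eventually_all _).2 fun k _ => by
        have hk : Continuous fun b : ℕ → Bool => b k := continuous_apply k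
        exact hk.continuousAt.eventually_mem ((isOpen_discrete {a k}).mem_nhds rfl)
    refine (continuousAt_const (y := if IsBranchCode a m then (1 : ℝ) else 0)).congr ?_
    filter_upwards [hev] with b hb
    have : IsBranchCode a m ↔ IsBranchCode b m := forall₂_congr fun k hk => by
      rw [hb k (Finset.mem_range.2 hk)]
    simp only [this]
  · have h := sparse_term_le 0 m
    simp only [add_zero, ne_eq, OfNat.ofNat_ne_zero, not_false_eq_true, zero_pow, pow_zero,
      one_mul] at h
    rw [norm_mul, Real.norm_eq_abs, Real.norm_of_nonneg (by positivity)]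
    exact (mul_le_of_le_one_left (by positivity) (abs_ite_one_zero_le _)).trans h

/-- In an integer relation the combined digits vanish eventually. At a large code of the branch `i`
no other branch contributes, so that digit is the coefficient `g i`. -/
lemma linearIndependent_branchReal : LinearIndependent ℚ branchReal := by
  classical
  rw [← LinearIndependent.iff_fractionRing ℤ ℚ, linearIndependent_iff']
  intro s g hg i hi
  let e : ℕ → ℤ := fun m => ∑ a ∈ s, g a * if IsBranchCode a m then 1 else 0
  have hC : ∀ m, |(e m : ℝ)| ≤ ∑ a ∈ s, |(g a : ℝ)| := fun m => by
    simp only [e, Int.cast_sum, Int.cast_mul, Int.cast_ite, Int.cast_one, Int.cast_zero]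
    refine (Finset.abs_sum_le_sum_abs _ _).trans (Finset.sum_le_sum fun a _ => ?_)
    rw [abs_mul]
    exact mul_le_of_le_one_right (abs_nonneg _) (abs_ite_one_zero_le _)
  have h0 : ∑' m, (e m : ℝ) * (1 / 2) ^ (m ^ 2) = 0 := by
    rw [← hg]
    have hsum : ∀ a, HasSum (fun m => g a • ((if IsBranchCode a m then (1 : ℝ) else 0) *
        (1 / 2) ^ (m ^ 2))) (g a • branchReal a) := fun a =>
      (summable_sparse fun m => abs_ite_one_zero_le (IsBranchCode a m)).hasSum.const_smul _
    rw [← (hasSum_sum fun a (_ : a ∈ s) => hsum a).tsum_eq]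
    refine tsum_congr fun m => ?_
    simp [e, Finset.sum_mul]
  have hsep : ∀ᶠ m in atTop, ∀ a ∈ s, a ≠ i → IsBranchCode i m → ¬ IsBranchCode a m := by
    rw [Finset.eventually_all]
    intro a _
    by_cases hai : a = i
    · exact Eventually.of_forall fun m h => absurd hai h
    · obtain ⟨k, hk⟩ := Function.ne_iff.1 (Ne.symm hai)
      filter_upwards [eventually_ge_atTop (2 ^ (k + 1))] with m hm _ h
      exact not_isBranchCode_of_ne hk hm h
  obtain ⟨n, hn⟩ := eventually_atTop.1 (hsep.and (eventually_eq_zero_of_sparse_tsum_eq_zero hC h0))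
  obtain ⟨m, hm, hcode⟩ := exists_isBranchCode_ge i n
  obtain ⟨h1, h2⟩ := hn m (n.lt_two_pow_self.le.trans hm)
  simp only [e] at h2
  rwa [Finset.sum_eq_single_of_mem i hi fun a ha hai => by simp [h1 a ha hai hcode],
    if_pos hcode, mul_one] at h2

lemma exists_perfect_linearIndepOn_rat :
    ∃ H₀ : Set ℝ, H₀ ⊆ Icc 1 2 ∧ H₀.Nonempty ∧ Perfect H₀ ∧ LinearIndepOn ℚ (id : ℝ → ℝ) H₀ := by
  refine ⟨range branchReal, ?_, range_nonempty _, ⟨?_, ?_⟩, ?_⟩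
  · rintro _ ⟨a, rfl⟩
    exact ⟨one_le_branchReal a, branchReal_le_two a⟩
  · exact (isCompact_range continuous_branchReal).isClosed
  · rintro _ ⟨a, rfl⟩
    rw [accPt_iff_nhds]
    intro U hU
    -- Flipping ever later bits gives sequences converging to `a`; independence makes `branchReal`
    -- injective, so their images differ from that of `a`.
    have hlim : Tendsto (fun k => Function.update a k (!a k)) atTop (𝓝 a) := by
      rw [tendsto_pi_nhds]
      intro i
      refine tendsto_const_nhds.congr' ?_
      filter_upwards [eventually_gt_atTop i] with k hk
      rw [Function.update_of_ne hk.ne]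
    obtain ⟨k, hk⟩ := ((continuous_branchReal.tendsto a).comp hlim |>.eventually hU).exists
    refine ⟨_, ⟨hk, mem_range_self _⟩, fun h => ?_⟩
    have := congrFun (linearIndependent_branchReal.injective h) k
    simp at this
  · exact linearIndependent_branchReal.linearIndepOn_id

/-- An interval contains a three-term arithmetic progression, which is a rational dependence. -/
lemma interior_eq_empty_of_linearIndepOn_rat {S : Set ℝ} (h : LinearIndepOn ℚ (id : ℝ → ℝ) S) :
    interior S = ∅ := by
  rw [eq_empty_iff_forall_notMem]
  intro x hx
  obtain ⟨δ, hδ, hball⟩ := Metric.mem_nhds_iff.1 (mem_interior_iff_mem_nhds.1 hx)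
  have hmem : ∀ t, |t| < δ → x + t ∈ S := fun t ht => hball (by simpa [Real.dist_eq] using ht)
  have h1 : x + δ / 2 ∈ S := hmem _ (by rw [abs_of_pos] <;> linarith)
  have h2 : x + -(δ / 2) ∈ S := hmem _ (by rw [abs_neg, abs_of_pos] <;> linarith)
  have h3 : x ∈ S := by simpa using hmem 0 (by simpa)
  have hinj : Function.Injective (![⟨x, h3⟩, ⟨x + δ / 2, h1⟩, ⟨x + -(δ / 2), h2⟩] : Fin 3 → S) := by
    intro i j
    fin_cases i <;> fin_cases j <;> simp [hδ.ne'] <;> intro <;> linarith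
  have hli := Fintype.linearIndependent_iff.1 (LinearIndependent.comp h _ hinj) ![2, -1, -1] (by
    simp [Fin.sum_univ_three, Algebra.smul_def]; ring) 0
  simp at hli

lemma exists_isBaseSet : ∃ H₀ : Set ℝ, IsBaseSet H₀ := by
  obtain ⟨H₀, h1, h2, h3, h4⟩ := exists_perfect_linearIndepOn_rat
  exact ⟨H₀, h1, h2, h3, h4, interior_eq_empty_of_linearIndepOn_rat h4⟩

/-! ### Removing the right endpoints of the gaps of a perfect set -/

lemma mem_diff_rightEndpoints_iff {H : Set ℝ} {y : ℝ} :
    y ∈ H \ rightEndpoints H ↔ y ∈ H ∧ ∀ a < y, ∃ x ∈ H, a < x ∧ x < y := by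
  simp only [rightEndpoints, Set.mem_sdiff, mem_ofPred_eq, not_and, not_exists, ← ne_eq,
    ← nonempty_iff_ne_empty]
  refine and_congr_right fun hy => ⟨fun h a ha => ?_, fun h _ a ha => ?_⟩
  · obtain ⟨x, hx, hxH⟩ := h hy a ha
    exact ⟨x, hxH, hx⟩
  · obtain ⟨x, hxH, hx⟩ := h a ha
    exact ⟨x, hx, hxH⟩

/-- The left endpoint of the gap of `H` around `r`. -/
lemma exists_gap_left {H : Set ℝ} (hcl : IsClosed H) (hpf : Preperfect H) {h r : ℝ}
    (hh : h ∈ H) (hhr : h < r) (hr : r ∉ H) :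
    ∃ a ∈ H \ rightEndpoints H, h ≤ a ∧ a < r ∧ Ioo a r ∩ H = ∅ := by
  have hne : (H ∩ Iic r).Nonempty := ⟨h, hh, hhr.le⟩
  have hbd : BddAbove (H ∩ Iic r) := ⟨r, fun _ hx => hx.2⟩
  have hmem : sSup (H ∩ Iic r) ∈ H ∩ Iic r := (hcl.inter isClosed_Iic).csSup_mem hne hbd
  have hub : ∀ x ∈ H, x ≤ r → x ≤ sSup (H ∩ Iic r) := fun x hx hxr => le_csSup hbd ⟨hx, hxr⟩
  set a := sSup (H ∩ Iic r)
  have har : a < r := lt_of_le_of_ne hmem.2 fun h => hr (h ▸ hmem.1)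
  refine ⟨a, mem_diff_rightEndpoints_iff.2 ⟨hmem.1, fun z hz => ?_⟩, hub h hh hhr.le, har, ?_⟩
  -- No point of `H` lies in `(a, r)`, so `H` accumulates at `a` from the left.
  · obtain ⟨y, ⟨hy, hyH⟩, hya⟩ := accPt_iff_nhds.1 (hpf a hmem.1) _ (Ioo_mem_nhds hz har)
    exact ⟨y, hyH, hy.1, lt_of_le_of_ne (hub y hyH hy.2.le) hya⟩
  · rw [eq_empty_iff_forall_notMem]
    rintro x ⟨⟨hax, hxr⟩, hxH⟩
    exact hax.not_ge (hub x hxH hxr.le)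

lemma exists_gap_right {H : Set ℝ} (hcl : IsClosed H) {h r : ℝ} (hh : h ∈ H) (hhr : r < h)
    (hr : r ∉ H) : ∃ b ∈ H, r < b ∧ b ≤ h ∧ Ioo r b ∩ H = ∅ := by
  have hne : (H ∩ Ici r).Nonempty := ⟨h, hh, hhr.le⟩
  have hbd : BddBelow (H ∩ Ici r) := ⟨r, fun _ hx => hx.2⟩
  have hmem : sInf (H ∩ Ici r) ∈ H ∩ Ici r := (hcl.inter isClosed_Ici).csInf_mem hne hbd
  have hlb : ∀ x ∈ H, r ≤ x → sInf (H ∩ Ici r) ≤ x := fun x hx hxr => csInf_le hbd ⟨hx, hxr⟩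
  set b := sInf (H ∩ Ici r)
  refine ⟨b, hmem.1, lt_of_le_of_ne hmem.2 fun h => hr (h ▸ hmem.1), hlb h hh hhr.le, ?_⟩
  rw [eq_empty_iff_forall_notMem]
  rintro x ⟨⟨hrx, hxb⟩, hxH⟩
  exact hxb.not_ge (hlb x hxH hrx.le)

/-- A point of `H` that is not the right endpoint of a gap is a limit from the left of such
points. -/
lemma exists_mem_diff_rightEndpoints_between {H : Set ℝ} (hcl : IsClosed H) (hpf : Preperfect H)
    {y z : ℝ} (hy : y ∈ H \ rightEndpoints H) (hz : z < y) :
    ∃ t ∈ H \ rightEndpoints H, z < t ∧ t < y := by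
  obtain ⟨-, hlim⟩ := mem_diff_rightEndpoints_iff.1 hy
  obtain ⟨h, hh, hzh, hhy⟩ := hlim z hz
  -- Either `H` fills `(h, y)` and any point inside serves, or a missing point yields a gap whose
  -- left endpoint serves.
  by_cases hsub : ∀ r, h < r → r < y → r ∈ H
  · obtain ⟨m, hhm, hmy⟩ := exists_between hhy
    refine ⟨m, mem_diff_rightEndpoints_iff.2 ⟨hsub m hhm hmy, fun a ha => ?_⟩, hzh.trans hhm, hmy⟩
    obtain ⟨x, hx, hxm⟩ := exists_between (max_lt ha hhm)
    exact ⟨x, hsub x ((le_max_right _ _).trans_lt hx) (hxm.trans hmy),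
      (le_max_left _ _).trans_lt hx, hxm⟩
  · push Not at hsub
    obtain ⟨r, hhr, hry, hr⟩ := hsub
    obtain ⟨a, ha, hha, har, -⟩ := exists_gap_left hcl hpf hh hhr hr
    exact ⟨a, ha, hzh.trans_le hha, har.trans hry⟩

lemma add_mem_diff_rightEndpoints {H : Set ℝ} (hadd : ∀ x ∈ H, ∀ y ∈ H, x + y ∈ H) {x y : ℝ}
    (hx : x ∈ H) (hy : y ∈ H \ rightEndpoints H) : x + y ∈ H \ rightEndpoints H := by
  obtain ⟨hyH, hlim⟩ := mem_diff_rightEndpoints_iff.1 hy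
  refine mem_diff_rightEndpoints_iff.2 ⟨hadd x hx y hyH, fun a ha => ?_⟩
  obtain ⟨t, ht, h1, h2⟩ := hlim (a - x) (by linarith)
  exact ⟨x + t, hadd x hx t ht, by linarith, by linarith⟩

/-- A set of reals without least and greatest element, in which every point is a limit from the
left and which is closed under limits from the left, is order isomorphic to the line. -/
theorem nonempty_orderIso_real {T : Set ℝ} (hne : T.Nonempty) (hmax : ∀ y ∈ T, ∃ t ∈ T, y < t)
    (hleft : ∀ y ∈ T, ∀ z < y, ∃ t ∈ T, z < t ∧ t < y)
    (hsup : ∀ S ⊆ T, S.Nonempty → BddAbove S → (∀ s ∈ S, ∃ t ∈ S, s < t) → sSup S ∈ T) :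
    Nonempty (ℝ ≃o T) := by
  obtain ⟨D, hDc, hDd⟩ := TopologicalSpace.exists_countable_dense T
  have hbetween : ∀ (y : T) (z : ℝ), z < y → ∃ d ∈ D, z < (d : ℝ) ∧ d < y := by
    intro y z hz
    obtain ⟨t, ht, hzt, hty⟩ := hleft y y.2 z hz
    obtain ⟨d, hd, hdD⟩ := hDd.inter_open_nonempty {d : T | z < (d : ℝ) ∧ (d : ℝ) < y}
      ((isOpen_Ioo (a := z) (b := (y : ℝ))).preimage continuous_subtype_val) ⟨⟨t, ht⟩, hzt, hty⟩
    exact ⟨d, hdD, hd.1, hd.2⟩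
  have : Countable D := hDc
  have : DenselyOrdered D := ⟨fun x y hxy => by
    obtain ⟨d, hd, h1, h2⟩ := hbetween y x hxy
    exact ⟨⟨d, hd⟩, h1, h2⟩⟩
  have : NoMinOrder D := ⟨fun x => by
    obtain ⟨d, hd, -, h2⟩ := hbetween x ((x : T) - 1) (by linarith)
    exact ⟨⟨d, hd⟩, h2⟩⟩
  have : NoMaxOrder D := ⟨fun x => by
    obtain ⟨t, ht, hxt⟩ := hmax x x.1.2
    obtain ⟨d, hd, h1, -⟩ := hbetween ⟨t, ht⟩ (x : T) hxt
    exact ⟨⟨d, hd⟩, h1⟩⟩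
  have : Nonempty D := by
    obtain ⟨y, hy⟩ := hne
    obtain ⟨d, hd, -⟩ := hbetween ⟨y, hy⟩ (y - 1) (by simp)
    exact ⟨⟨d, hd⟩⟩
  -- Cantor's theorem identifies the countable dense subset with `ℚ`; suprema of lower cuts extend
  -- this to `ℝ`.
  obtain ⟨e⟩ := Order.iso_of_countable_dense ℚ D
  let v : ℚ → ℝ := fun q => ((e q : T) : ℝ)
  have hv : StrictMono v := e.strictMono
  have hvT : ∀ q, v q ∈ T := fun q => (e q : T).2
  let L : ℝ → Set ℝ := fun x => v '' {q | (q : ℝ) < x}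
  have hLne : ∀ x, (L x).Nonempty := fun x =>
    let ⟨q, hq⟩ := exists_rat_lt x
    ⟨v q, q, hq, rfl⟩
  have hLbd : ∀ (x : ℝ) (q : ℚ), x ≤ q → v q ∈ upperBounds (L x) := by
    rintro x q hq _ ⟨p, hp, rfl⟩
    exact hv.monotone (by exact_mod_cast hp.le.trans hq)
  have hLbdd : ∀ x, BddAbove (L x) := fun x =>
    let ⟨q, hq⟩ := exists_rat_gt x
    ⟨_, hLbd x q hq.le⟩
  have hLT : ∀ x, sSup (L x) ∈ T := fun x => by
    refine hsup _ ?_ (hLne x) (hLbdd x) ?_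
    · rintro _ ⟨q, -, rfl⟩
      exact hvT q
    · rintro _ ⟨q, hq, rfl⟩
      obtain ⟨p, hqp, hpx⟩ := exists_rat_btwn (show (q : ℝ) < x from hq)
      exact ⟨v p, ⟨p, hpx, rfl⟩, hv (by exact_mod_cast hqp)⟩
  let f : ℝ → T := fun x => ⟨sSup (L x), hLT x⟩
  have hmono : StrictMono f := fun x y hxy => by
    obtain ⟨p, hxp, hpy⟩ := exists_rat_btwn hxy
    obtain ⟨q, hpq, hqy⟩ := exists_rat_btwn hpy
    calc sSup (L x) ≤ v p := csSup_le (hLne x) (hLbd x p hxp.le)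
      _ < v q := hv (by exact_mod_cast hpq)
      _ ≤ sSup (L y) := le_csSup (hLbdd y) ⟨q, hqy, rfl⟩
  have hsurj : Function.Surjective f := fun y => by
    let S : Set ℝ := Rat.cast '' {q : ℚ | v q < y}
    have hlow : ∀ z < (y : ℝ), ∃ q, z < v q ∧ v q < y := fun z hz => by
      obtain ⟨d, hd, h1, h2⟩ := hbetween y z hz
      refine ⟨e.symm ⟨d, hd⟩, ?_⟩
      simp only [v, OrderIso.apply_symm_apply]
      exact ⟨h1, h2⟩
    have hSne : S.Nonempty :=
      let ⟨q, _, hq⟩ := hlow (y - 1) (by simp)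
      ⟨q, q, hq, rfl⟩
    have hSbd : BddAbove S := by
      obtain ⟨t, ht, hyt⟩ := hmax y y.2
      obtain ⟨d, hd, h1, -⟩ := hbetween ⟨t, ht⟩ (y : ℝ) hyt
      refine ⟨(e.symm ⟨d, hd⟩ : ℚ), ?_⟩
      rintro _ ⟨q, hq, rfl⟩
      have : v q < v (e.symm ⟨d, hd⟩) := by
        simp only [v, OrderIso.apply_symm_apply]
        exact lt_trans hq h1
      exact_mod_cast (hv.lt_iff_lt.1 this).le
    have hiff : ∀ q : ℚ, (q : ℝ) < sSup S ↔ v q < y := fun q => by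
      refine ⟨fun h => ?_, fun h => ?_⟩
      · obtain ⟨_, ⟨p, hp, rfl⟩, hqp⟩ := exists_lt_of_lt_csSup hSne h
        exact (hv (by exact_mod_cast hqp)).trans hp
      · obtain ⟨p, h1, h2⟩ := hlow _ h
        exact lt_of_lt_of_le (by exact_mod_cast hv.lt_iff_lt.1 h1) (le_csSup hSbd ⟨p, h2, rfl⟩)
    refine ⟨sSup S, Subtype.ext ?_⟩
    refine csSup_eq_of_forall_le_of_forall_lt_exists_gt (hLne _) ?_ fun z hz => ?_
    · rintro _ ⟨q, hq, rfl⟩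
      exact ((hiff q).1 hq).le
    · obtain ⟨q, h1, h2⟩ := hlow z hz
      exact ⟨v q, ⟨q, (hiff q).2 h2, rfl⟩, h1⟩
  exact ⟨hmono.orderIsoOfSurjective f hsurj⟩

theorem nonempty_orderIso_real_diff_rightEndpoints {H : Set ℝ} (hcl : IsClosed H)
    (hpf : Preperfect H) (hne : (H \ rightEndpoints H).Nonempty)
    (hmax : ∀ y ∈ H \ rightEndpoints H, ∃ t ∈ H \ rightEndpoints H, y < t) :
    Nonempty (ℝ ≃o ↥(H \ rightEndpoints H)) := by
  refine nonempty_orderIso_real hne hmax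
    (fun y hy z hz => exists_mem_diff_rightEndpoints_between hcl hpf hy hz) fun S hST hS hbd hno => ?_
  have hSH : S ⊆ H := hST.trans sdiff_subset
  refine mem_diff_rightEndpoints_iff.2
    ⟨hcl.closure_subset_iff.2 hSH (csSup_mem_closure hS hbd), fun a ha => ?_⟩
  obtain ⟨s, hs, has⟩ := exists_lt_of_lt_csSup hS ha
  obtain ⟨t, ht, hst⟩ := hno s hs
  exact ⟨s, hSH hs, has, hst.trans_le (le_csSup hbd ht)⟩

/-! ### The additive semigroup generated by a perfect set -/

section GeneratedSet

variable {H₀ : Set ℝ}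

lemma layer_mono : Monotone (layer 1 1 H₀) :=
  monotone_nat_of_le_succ fun _ => subset_union_left

lemma layer_subset_generatedSet (i : ℕ) : layer 1 1 H₀ i ⊆ generatedSet 1 1 H₀ :=
  subset_iUnion _ i

lemma subset_generatedSet : H₀ ⊆ generatedSet 1 1 H₀ :=
  layer_subset_generatedSet 0

lemma add_mem_layer_succ {i : ℕ} {x y : ℝ} (hx : x ∈ layer 1 1 H₀ i) (hy : y ∈ layer 1 1 H₀ i) :
    x + y ∈ layer 1 1 H₀ (i + 1) :=
  Or.inr ⟨x, hx, y, hy, by ring⟩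

lemma add_mem_generatedSet : ∀ x ∈ generatedSet 1 1 H₀, ∀ y ∈ generatedSet 1 1 H₀,
    x + y ∈ generatedSet 1 1 H₀ := by
  intro x hx y hy
  obtain ⟨i, hi⟩ := mem_iUnion.1 hx
  obtain ⟨j, hj⟩ := mem_iUnion.1 hy
  exact layer_subset_generatedSet _ (add_mem_layer_succ (layer_mono (le_max_left i j) hi)
    (layer_mono (le_max_right i j) hj))

lemma generatedSet_induction {p : ℝ → Prop} (h0 : ∀ x ∈ H₀, p x)
    (hadd : ∀ x ∈ generatedSet 1 1 H₀, ∀ y ∈ generatedSet 1 1 H₀, p x → p y → p (x + y)) :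
    ∀ x ∈ generatedSet 1 1 H₀, p x := by
  intro x hx
  obtain ⟨i, hi⟩ := mem_iUnion.1 hx
  clear hx
  induction i generalizing x with
  | zero => exact h0 x hi
  | succ i ih =>
    rcases hi with hi | ⟨y, hy, z, hz, rfl⟩
    · exact ih x hi
    · rw [one_mul, one_mul]
      exact hadd y (layer_subset_generatedSet i hy) z (layer_subset_generatedSet i hz)
        (ih y hy) (ih z hz)

lemma mem_or_exists_add_of_mem_generatedSet : ∀ x ∈ generatedSet 1 1 H₀,
    x ∈ H₀ ∨ ∃ h ∈ H₀, ∃ y ∈ generatedSet 1 1 H₀, x = h + y := by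
  refine generatedSet_induction (fun x hx => Or.inl hx) ?_
  rintro x - y hy (hx | ⟨h, hh, z, hz, rfl⟩) -
  · exact Or.inr ⟨x, hx, y, hy, rfl⟩
  · exact Or.inr ⟨h, hh, z + y, add_mem_generatedSet z hz y hy, add_assoc _ _ _⟩

lemma one_le_of_mem_generatedSet (h1 : ∀ x ∈ H₀, 1 ≤ x) : ∀ x ∈ generatedSet 1 1 H₀, 1 ≤ x :=
  generatedSet_induction h1 fun _ _ _ _ hx hy => by linarith

lemma mem_of_mem_generatedSet_of_lt_two (h1 : ∀ x ∈ H₀, 1 ≤ x) {x : ℝ}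
    (hx : x ∈ generatedSet 1 1 H₀) (hx2 : x < 2) : x ∈ H₀ := by
  obtain h | ⟨h, hh, y, hy, rfl⟩ := mem_or_exists_add_of_mem_generatedSet x hx
  · exact h
  · linarith [h1 h hh, one_le_of_mem_generatedSet h1 y hy]

/-- Splitting off a summand from `H₀` lowers the element by at least 1. Bounded parts of `H` thus
lie in one compact layer, which makes `H` closed. -/
lemma mem_layer_of_le (h1 : ∀ x ∈ H₀, 1 ≤ x) (n : ℕ) :
    ∀ x ∈ generatedSet 1 1 H₀, x ≤ n → x ∈ layer 1 1 H₀ n := by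
  induction n with
  | zero =>
    intro x hx hxn
    have := one_le_of_mem_generatedSet h1 x hx
    simp only [CharP.cast_eq_zero] at hxn
    linarith
  | succ n ih =>
    intro x hx hxn
    obtain h | ⟨h, hh, y, hy, rfl⟩ := mem_or_exists_add_of_mem_generatedSet x hx
    · exact layer_mono (Nat.zero_le _) h
    · push_cast at hxn
      exact add_mem_layer_succ (layer_mono (Nat.zero_le n) hh) (ih y hy (by linarith [h1 h hh]))

lemma isCompact_layer (h0 : IsCompact H₀) (i : ℕ) : IsCompact (layer 1 1 H₀ i) := by
  induction i with
  | zero => exact h0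
  | succ i ih =>
    refine ih.union ?_
    convert ih.add ih using 1
    ext z
    simp only [mem_ofPred_eq, one_mul, Set.mem_add, eq_comm]

lemma isClosed_generatedSet (h0 : IsCompact H₀) (h1 : ∀ x ∈ H₀, 1 ≤ x) :
    IsClosed (generatedSet 1 1 H₀) := by
  refine isClosed_of_closure_subset fun x hx => ?_
  obtain ⟨n, hn⟩ := exists_nat_gt x
  have hx' : x ∈ closure (Iio (n : ℝ) ∩ generatedSet 1 1 H₀) :=
    isOpen_Iio.inter_closure ⟨hn, hx⟩
  refine layer_subset_generatedSet n ((isCompact_layer h0 n).isClosed.closure_subset_iff.2 ?_ hx')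
  exact fun y hy => mem_layer_of_le h1 n y hy.2 hy.1.le

lemma preperfect_generatedSet (h0 : Preperfect H₀) : Preperfect (generatedSet 1 1 H₀) := by
  refine generatedSet_induction (fun x hx => (h0 x hx).mono (principal_mono.2 subset_generatedSet))
    fun x _ y hy hacc _ => ?_
  rw [accPt_iff_nhds] at hacc ⊢
  intro U hU
  have hcont : ContinuousAt (fun t => t + y) x := by fun_prop
  obtain ⟨t, ⟨htU, ht⟩, htx⟩ := hacc _ (hcont hU)
  exact ⟨t + y, ⟨htU, add_mem_generatedSet t ht y hy⟩, fun h => htx (add_right_cancel h)⟩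

/-- Below 2 the set `H` coincides with `H₀`, which contains no interval; a point missing between two
points of `H₀` lies in a gap of `H`. -/
lemma exists_gap_generatedSet (h : IsBaseSet H₀) :
    ∃ a ∈ trimmedSet 1 1 H₀, ∃ b ∈ generatedSet 1 1 H₀, a < b ∧
      Ioo a b ∩ generatedSet 1 1 H₀ = ∅ := by
  obtain ⟨hsub, ⟨x, hx⟩, hperf, -, hint⟩ := h
  have h1 : ∀ x ∈ H₀, 1 ≤ x := fun x hx => (hsub hx).1
  have hcl := isClosed_generatedSet (isCompact_Icc.of_isClosed_subset hperf.closed hsub) h1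
  obtain ⟨y, ⟨-, hy⟩, hyx⟩ := accPt_iff_nhds.1 (hperf.acc x hx) univ univ_mem
  wlog hxy : x < y generalizing x y
  · exact this y hy x hyx.symm hx (lt_of_le_of_ne (not_lt.1 hxy) hyx)
  have hnot : ¬ Ioo x y ⊆ H₀ := fun hss => by
    have := interior_maximal hss isOpen_Ioo
    rw [hint] at this
    exact (nonempty_Ioo.2 hxy).not_subset_empty this
  obtain ⟨r, ⟨hxr, hry⟩, hr⟩ := not_subset.1 hnot
  have hrH : r ∉ generatedSet 1 1 H₀ := fun hrH =>
    hr (mem_of_mem_generatedSet_of_lt_two h1 hrH (hry.trans_le (hsub hy).2))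
  obtain ⟨a, ha, -, har, hgapl⟩ := exists_gap_left hcl (preperfect_generatedSet hperf.acc)
    (subset_generatedSet hx) hxr hrH
  obtain ⟨b, hb, hrb, -, hgapr⟩ := exists_gap_right hcl (subset_generatedSet hy) hry hrH
  refine ⟨a, ha, b, hb, har.trans hrb, ?_⟩
  rw [eq_empty_iff_forall_notMem] at hgapl hgapr ⊢
  rintro t ⟨⟨hat, htb⟩, ht⟩
  rcases lt_trichotomy t r with htr | rfl | hrt
  · exact hgapl t ⟨⟨hat, htr⟩, ht⟩
  · exact hrH ht
  · exact hgapr t ⟨⟨hrt, htb⟩, ht⟩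

lemma exists_between_trimmedSet (h : IsBaseSet H₀) {y z : ℝ} (hy : y ∈ trimmedSet 1 1 H₀)
    (hz : z < y) : ∃ t ∈ trimmedSet 1 1 H₀, z < t ∧ t < y :=
  exists_mem_diff_rightEndpoints_between
    (isClosed_generatedSet (isCompact_Icc.of_isClosed_subset h.2.2.1.closed h.1)
      fun _ hx => (h.1 hx).1)
    (preperfect_generatedSet h.2.2.1.acc) hy hz

/-- Only one summand needs to be in `H'`; the other may be the right endpoint of a gap. -/
lemma add_mem_trimmedSet {x y : ℝ} (hx : x ∈ generatedSet 1 1 H₀) (hy : y ∈ trimmedSet 1 1 H₀) :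
    x + y ∈ trimmedSet 1 1 H₀ :=
  add_mem_diff_rightEndpoints add_mem_generatedSet hx hy

theorem nonempty_orderIso_real_trimmedSet (h : IsBaseSet H₀) :
    Nonempty (ℝ ≃o trimmedSet 1 1 H₀) := by
  have h1 : ∀ x ∈ H₀, 1 ≤ x := fun x hx => (h.1 hx).1
  refine nonempty_orderIso_real_diff_rightEndpoints
    (isClosed_generatedSet (isCompact_Icc.of_isClosed_subset h.2.2.1.closed h.1) h1)
    (preperfect_generatedSet h.2.2.1.acc) ?_ fun y hy => ?_
  · obtain ⟨a, ha, -⟩ := exists_gap_generatedSet h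
    exact ⟨a, ha⟩
  · obtain ⟨x, hx⟩ := h.2.1
    exact ⟨x + y, add_mem_trimmedSet (subset_generatedSet hx) hy, by linarith [h1 x hx]⟩

end GeneratedSet

/-! ### The operation -/

section Operation

variable {I : Set ℝ} {Y : Set ℝ} {f : I ≃o Y}
  {h : ∀ x y : I, (1 : ℝ) * (f x : ℝ) + 1 * (f y : ℝ) ∈ Y}

lemma coe_apply_weightedQuasiSum (x y : I) :
    (f (weightedQuasiSum 1 1 f h (x, y)) : ℝ) = f x + f y := by
  simp [weightedQuasiSum]

lemma weightedQuasiSum_ext {x y : I} (hxy : (f x : ℝ) = f y) : x = y :=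
  f.injective (Subtype.ext hxy)

lemma isAssociative_weightedQuasiSum : IsAssociative (weightedQuasiSum 1 1 f h) := fun x y z =>
  weightedQuasiSum_ext (f := f) (by simp only [coe_apply_weightedQuasiSum]; ring)

lemma isSymmetric_weightedQuasiSum : IsSymmetric (weightedQuasiSum 1 1 f h) := fun x y =>
  weightedQuasiSum_ext (f := f) (by simp only [coe_apply_weightedQuasiSum]; ring)

lemma isBisymmetric_weightedQuasiSum : IsBisymmetric (weightedQuasiSum 1 1 f h) := fun x y u v =>
  weightedQuasiSum_ext (f := f) (by simp only [coe_apply_weightedQuasiSum]; ring)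

lemma weightedQuasiSum_lt_iff {x y z : I} :
    weightedQuasiSum 1 1 f h (x, y) < z ↔ (f x : ℝ) + f y < f z := by
  rw [← f.lt_iff_lt, ← Subtype.coe_lt_coe, coe_apply_weightedQuasiSum]

lemma isPartiallyStrictlyIncreasing_weightedQuasiSum :
    IsPartiallyStrictlyIncreasing (weightedQuasiSum 1 1 f h) := by
  refine ⟨fun z x y hxy => ?_, fun z x y hxy => ?_⟩ <;>
  · have : (f x : ℝ) < f y := f.strictMono hxy
    rw [weightedQuasiSum_lt_iff, coe_apply_weightedQuasiSum]
    linarith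

end Operation

lemma not_continuous_weightedQuasiSum_section {H₀ : Set ℝ} (h₀ : IsBaseSet H₀)
    {f : (univ : Set ℝ) ≃o trimmedSet 1 1 H₀}
    {h : ∀ x y, (1 : ℝ) * (f x : ℝ) + 1 * (f y : ℝ) ∈ trimmedSet 1 1 H₀} (x₀ : (univ : Set ℝ)) :
    ¬ Continuous fun y => weightedQuasiSum 1 1 f h (x₀, y) := fun hcont => by
  obtain ⟨a, ha, b, hb, hab, hgap⟩ := exists_gap_generatedSet h₀
  -- If the section were continuous, it would stay below `f⁻¹ c` slightly to the right of `f⁻¹ a`,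
  -- forcing a value of `f` into the gap.
  obtain ⟨c, hc, hac, hcb⟩ := exists_between_trimmedSet h₀
    (add_mem_trimmedSet hb (f x₀).2) (z := f x₀ + a) (by linarith)
  set u := f.symm ⟨c, hc⟩ with hu
  have hopen : IsOpen {t : ℝ | weightedQuasiSum 1 1 f h (x₀, ⟨t, mem_univ t⟩) < u} :=
    isOpen_Iio.preimage (hcont.comp (continuous_id.subtype_mk mem_univ))
  have hmem : (f.symm ⟨a, ha⟩ : ℝ) ∈
      {t : ℝ | weightedQuasiSum 1 1 f h (x₀, ⟨t, mem_univ t⟩) < u} := by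
    simpa [weightedQuasiSum_lt_iff, hu] using hac
  obtain ⟨t, ht, hlt⟩ := ((eventually_nhdsWithin_of_eventually_nhds
    (hopen.mem_nhds hmem)).and (self_mem_nhdsWithin (s := Ioi (f.symm ⟨a, ha⟩ : ℝ)))).exists
  have hta : a < f ⟨t, mem_univ t⟩ := by
    have : f.symm ⟨a, ha⟩ < ⟨t, mem_univ t⟩ := hlt
    exact f.symm_apply_lt.1 this
  have htc : (f x₀ : ℝ) + f ⟨t, mem_univ t⟩ < c := by
    have := weightedQuasiSum_lt_iff.1 ht
    simpa [hu] using this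
  have htb : (f ⟨t, mem_univ t⟩ : ℝ) < b := by linarith
  exact (eq_empty_iff_forall_notMem.1 hgap) _ ⟨⟨hta, htb⟩, (f ⟨t, mem_univ t⟩).2.1⟩

lemma IsContinuousQuasiSum.continuous_section {I : Set ℝ} [I.OrdConnected] {F : I × I → I}
    (hF : IsContinuousQuasiSum F) (x₀ : I) : Continuous fun y => F (x₀, y) := by
  obtain ⟨J, f, ⟨hJ, -⟩, hcont, hmono, hsurj, hsum⟩ := hF
  let e : J ≃o I := hmono.orderIsoOfSurjective f hsurj
  have hfe : ∀ y, f (e.symm y) = y := e.apply_symm_apply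
  choose hmem heq using hsum
  have hsec : (fun y => F (x₀, y)) =
      fun y => f ⟨(e.symm x₀ : ℝ) + e.symm y, hmem _ _⟩ := by
    funext y
    rw [← heq, hfe, hfe]
  rw [hsec]
  -- The inverse is continuous because it is an order isomorphism between order convex sets.
  refine hcont.comp (Continuous.subtype_mk ?_ _)
  exact continuous_const.add (continuous_subtype_val.comp e.symm.continuous)

end IntervalOp

open IntervalOp Set

theorem mainTheorem2 :
    ∃ (I : Set ℝ) (F : I × I → I),
      IntervalOp.IsProperInterval I ∧
      IntervalOp.IsAssociative F ∧
      IntervalOp.IsPartiallyStrictlyIncreasing F ∧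
      ¬ Continuous F ∧
      (∀ x₀ : I, ¬ Continuous fun y : I => F (x₀, y)) ∧
      (∀ y₀ : I, ¬ Continuous fun x : I => F (x, y₀)) ∧
      IntervalOp.IsSymmetric F ∧
      IntervalOp.IsBisymmetric F ∧
      (∃ H₀ : Set ℝ, IntervalOp.IsBaseSet H₀ ∧
        ∃ (f : I ≃o IntervalOp.trimmedSet 1 1 H₀)
          (h : ∀ x y : I, (1 : ℝ) * (f x : ℝ) + 1 * (f y : ℝ) ∈ IntervalOp.trimmedSet 1 1 H₀),
          F = IntervalOp.weightedQuasiSum 1 1 f h) ∧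
      ¬ IntervalOp.IsContinuousQuasiSum F := by
  obtain ⟨H₀, h₀⟩ := exists_isBaseSet
  obtain ⟨e⟩ := nonempty_orderIso_real_trimmedSet h₀
  let f : (univ : Set ℝ) ≃o trimmedSet 1 1 H₀ := OrderIso.Set.univ.trans e
  have h : ∀ x y, (1 : ℝ) * (f x : ℝ) + 1 * (f y : ℝ) ∈ trimmedSet 1 1 H₀ := fun x y => by
    rw [one_mul, one_mul]
    exact add_mem_trimmedSet (f x).2.1 (f y).2
  have hsec := not_continuous_weightedQuasiSum_section (h := h) h₀
  let x₀ : (univ : Set ℝ) := ⟨0, mem_univ 0⟩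
  refine ⟨univ, weightedQuasiSum 1 1 f h, ⟨ordConnected_univ, by simp⟩,
    isAssociative_weightedQuasiSum, isPartiallyStrictlyIncreasing_weightedQuasiSum,
    fun hF => hsec x₀ (hF.comp (by fun_prop)), hsec, fun y₀ hF => hsec y₀ ?_,
    isSymmetric_weightedQuasiSum, isBisymmetric_weightedQuasiSum, ⟨H₀, h₀, f, h, rfl⟩,
    fun hF => hsec x₀ (hF.continuous_section x₀)⟩
  simpa only [isSymmetric_weightedQuasiSum (h := h) y₀] using hF
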